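/- Let $G$ be a Polish group and let $(X,\mathcal X,\mu)$ be a standard Borel space with a probability measure. The measure algebra of $(X,\mathcal X,\mu)$ is the Boolean algebra of measurable sets modulo $\mu$-null sets, and its automorphism group $\mathrm{Aut}(\mu)$ (measure-preserving Boolean automorphisms) carries the group topology with subbasic neighbourhoods of the identity $\{T:\mu(A\,\triangle\,TA)<\varepsilon\}$. A boolean action of $G$ on $(X,\mathcal X,\mu)$ is a continuous homomorphism $G\to\mathrm{Aut}(\mu)$, written $A\mapsto gA$. The action is *whirly* if for all $A,B$ of positive measure, every neighbourhood of the identity of $G$ contains some $g$ with $\mu(A\cap gB)>0$. A *factor* is a $G$-invariant sub-$\sigma$-algebra $\mathcal D$ of the measure algebra; it is *trivial* if it consists only of the class of the null sets and the class of the sets of full measure. A factor $\mathcal D$ is *spatial* if there are a standard Borel probability space $(Y,\nu)$ and an action of $G$ on $Y$ such that the map $G\times Y\to Y$ is Borel, every $g\in G$ preserves $\nu$, and the measure algebra of $(Y,\nu)$, with the induced action $[B]\mapsto[gB]$, is isomorphic to $\mathcal D$ by a measure-preserving $G$-equivariant Boolean isomorphism. **Theorem.** A boolean action of a Polish group $G$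 on a standard Borel probability space is whirly if and only if it has no nontrivial spatial factor. -/

import Mathlib

open MeasureTheory
open scoped ENNReal Topology symmDiff

noncomputable section

namespace Whirly

/-- The measure algebra of `(X, μ)`: measurable subsets of `X` modulo `μ`-null sets, that is, the
quotient of `MeasuredSets μ` (measurable sets with the pseudo-distance `μ (A ∆ B)`) by the relation
`μ (A ∆ B) = 0`.  For a finite `μ` it carries the metric `dist [A] [B] = μ (A ∆ B)`. -/
abbrev MeasAlg {X : Type*} [MeasurableSpace X] (μ : Measure X) : Type _ :=
  SeparationQuotient (MeasuredSets μ)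

namespace MeasAlg

variable {X : Type*} [MeasurableSpace X] {μ : Measure X}

/-- The class `[A]` of a measurable set. -/
def mk (μ : Measure X) (A : Set X) (hA : MeasurableSet A) : MeasAlg μ :=
  SeparationQuotient.mk (X := MeasuredSets μ) ⟨A, hA⟩

theorem inseparable_iff (s t : MeasuredSets μ) :
    Inseparable s t ↔ (s : Set X) =ᵐ[μ] (t : Set X) := by
  rw [EMetric.inseparable_iff, MeasuredSets.edist_def, measure_symmDiff_eq_zero_iff]

theorem mk_eq_mk {A B : Set X} {hA : MeasurableSet A} {hB : MeasurableSet B} :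
    mk μ A hA = mk μ B hB ↔ A =ᵐ[μ] B :=
  SeparationQuotient.mk_eq_mk.trans (inseparable_iff _ _)

theorem ind {p : MeasAlg μ → Prop} (h : ∀ A hA, p (mk μ A hA)) (a : MeasAlg μ) : p a :=
  SeparationQuotient.surjective_mk.forall.2 (fun s => h s.1 s.2) a

/-- The Boolean algebra structure of the measure algebra, induced by the set operations:
`[A] ≤ [B]` iff `A ⊆ B` up to a null set, `[A] ⊔ [B] = [A ∪ B]`, `[A] ⊓ [B] = [A ∩ B]`,
`[A]ᶜ = [Aᶜ]`, `⊤ = [X]`, `⊥ = [∅]`. -/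
instance instBooleanAlgebra : BooleanAlgebra (MeasAlg μ) where
  le := SeparationQuotient.lift₂ (fun s t : MeasuredSets μ => (s : Set X) ≤ᵐ[μ] (t : Set X))
    (fun a b c d h₁ h₂ => propext
      (Filter.eventuallyLE_congr ((inseparable_iff _ _).1 h₁) ((inseparable_iff _ _).1 h₂)))
  sup := SeparationQuotient.lift₂
    (fun s t : MeasuredSets μ => mk μ (s.1 ∪ t.1) (s.2.union t.2))
    (fun a b c d h₁ h₂ => mk_eq_mk.2
      (Filter.EventuallyEq.union ((inseparable_iff _ _).1 h₁) ((inseparable_iff _ _).1 h₂)))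
  inf := SeparationQuotient.lift₂
    (fun s t : MeasuredSets μ => mk μ (s.1 ∩ t.1) (s.2.inter t.2))
    (fun a b c d h₁ h₂ => mk_eq_mk.2
      (Filter.EventuallyEq.inter ((inseparable_iff _ _).1 h₁) ((inseparable_iff _ _).1 h₂)))
  compl := SeparationQuotient.lift (fun s : MeasuredSets μ => mk μ (s.1ᶜ) s.2.compl)
    (fun a b h => mk_eq_mk.2 (Filter.EventuallyEq.compl ((inseparable_iff _ _).1 h)))
  top := mk μ Set.univ MeasurableSet.univ
  bot := mk μ ∅ MeasurableSet.empty
  le_refl := ind fun A hA => Filter.EventuallyLE.refl _ _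
  le_trans := ind fun A hA => ind fun B hB => ind fun C hC =>
    fun h₁ h₂ => Filter.EventuallyLE.trans (show A ≤ᵐ[μ] B from h₁) (show B ≤ᵐ[μ] C from h₂)
  le_antisymm := ind fun A hA => ind fun B hB =>
    fun h₁ h₂ => mk_eq_mk.2
      (Filter.EventuallyLE.antisymm (show A ≤ᵐ[μ] B from h₁) (show B ≤ᵐ[μ] A from h₂))
  le_sup_left := ind fun A hA => ind fun B hB =>
    show A ≤ᵐ[μ] (A ∪ B : Set X) from Filter.Eventually.of_forall fun x hx => Or.inl hx
  le_sup_right := ind fun A hA => ind fun B hB =>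
    show B ≤ᵐ[μ] (A ∪ B : Set X) from Filter.Eventually.of_forall fun x hx => Or.inr hx
  sup_le := ind fun A hA => ind fun B hB => ind fun C hC => fun h₁ h₂ =>
    show (A ∪ B : Set X) ≤ᵐ[μ] C by
      filter_upwards [show A ≤ᵐ[μ] C from h₁, show B ≤ᵐ[μ] C from h₂] with x k₁ k₂ hx
      exact hx.elim k₁ k₂
  inf_le_left := ind fun A hA => ind fun B hB =>
    show (A ∩ B : Set X) ≤ᵐ[μ] A from Filter.Eventually.of_forall fun x hx => hx.1
  inf_le_right := ind fun A hA => ind fun B hB =>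
    show (A ∩ B : Set X) ≤ᵐ[μ] B from Filter.Eventually.of_forall fun x hx => hx.2
  le_inf := ind fun A hA => ind fun B hB => ind fun C hC => fun h₁ h₂ =>
    show A ≤ᵐ[μ] (B ∩ C : Set X) by
      filter_upwards [show A ≤ᵐ[μ] B from h₁, show A ≤ᵐ[μ] C from h₂] with x k₁ k₂ hx
      exact ⟨k₁ hx, k₂ hx⟩
  le_sup_inf := ind fun A hA => ind fun B hB => ind fun C hC =>
    show ((A ∪ B) ∩ (A ∪ C) : Set X) ≤ᵐ[μ] (A ∪ B ∩ C : Set X) from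
      Filter.Eventually.of_forall fun x hx => (Set.union_inter_distrib_left A B C).symm.subset hx
  inf_compl_le_bot := ind fun A hA =>
    show (A ∩ Aᶜ : Set X) ≤ᵐ[μ] (∅ : Set X) from
      Filter.Eventually.of_forall fun x hx => (hx.2 hx.1).elim
  top_le_sup_compl := ind fun A hA =>
    show (Set.univ : Set X) ≤ᵐ[μ] (A ∪ Aᶜ : Set X) from
      Filter.Eventually.of_forall fun x _ => Classical.em (x ∈ A)
  le_top := ind fun A hA =>
    show A ≤ᵐ[μ] (Set.univ : Set X) from Filter.Eventually.of_forall fun x _ => trivial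
  bot_le := ind fun A hA =>
    show (∅ : Set X) ≤ᵐ[μ] A from Filter.Eventually.of_forall fun x hx => False.elim hx

/-- The measure on the measure algebra: `measure [A] = μ A`. -/
def measure : MeasAlg μ → ℝ≥0∞ :=
  SeparationQuotient.lift (fun s : MeasuredSets μ => μ (s : Set X))
    (fun _ _ h => measure_congr ((inseparable_iff _ _).1 h))

/-- The map `[B] ↦ [f⁻¹ B]` induced by a measure preserving map `f`. -/
def comap {Y : Type*} [MeasurableSpace Y] {ν : Measure Y} (f : X → Y)
    (hf : MeasurePreserving f μ ν) : MeasAlg ν → MeasAlg μ :=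
  SeparationQuotient.lift
    (fun s : MeasuredSets ν => mk μ (f ⁻¹' s.1) (hf.measurable s.2))
    (fun _ _ h => mk_eq_mk.2
      (hf.quasiMeasurePreserving.preimage_ae_eq ((inseparable_iff _ _).1 h)))

end MeasAlg

/-- The automorphism group of the measure algebra of `(X, μ)`: the measure preserving Boolean
automorphisms (a bijection between Boolean algebras is a Boolean isomorphism iff it is an order
isomorphism). -/
def Aut {X : Type*} [MeasurableSpace X] (μ : Measure X) : Subgroup (MeasAlg μ ≃o MeasAlg μ) where
  carrier := {T | ∀ A, (T A).measure = A.measure}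
  one_mem' := fun _ => rfl
  mul_mem' := fun {S T} hS hT A => (hS (T A)).trans (hT A)
  inv_mem' := fun {T} hT A => by
    have h := hT (T.symm A)
    rw [T.apply_symm_apply] at h
    exact h.symm

/-- The usual (weak) topology of the automorphism group: that of pointwise convergence for the
metric `μ (A ∆ B)`.  It is the group topology with subbasic neighbourhoods of the identity
`{T | μ (A ∆ T A) < ε}`. -/
instance Aut.instTopologicalSpace {X : Type*} [MeasurableSpace X] (μ : Measure X) :
    TopologicalSpace (Aut μ) :=
  TopologicalSpace.induced (fun (T : Aut μ) (A : MeasAlg μ) => T.1 A) Pi.topologicalSpace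

/-- A boolean action of `G` on `(X, μ)`: a continuous homomorphism from `G` to the automorphism
group of the measure algebra. -/
abbrev BooleanAction (G : Type*) [Group G] [TopologicalSpace G] {X : Type*} [MeasurableSpace X]
    (μ : Measure X) : Type _ :=
  G →ₜ* Aut μ

section

variable {G : Type*} [Group G] [TopologicalSpace G] {X : Type*} [MeasurableSpace X] {μ : Measure X}

/-- A boolean action is whirly if for all `A, B` of positive measure, every neighbourhood of the
identity contains some `g` with `μ (A ∩ g B) > 0`. -/
def IsWhirly (α : BooleanAction G μ) : Prop :=
  ∀ A B : MeasAlg μ, 0 < A.measure → 0 < B.measure →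
    ∀ U ∈ 𝓝 (1 : G), ∃ g ∈ U, 0 < (A ⊓ (α g).1 B).measure

/-- A factor of a boolean action: a `G`-invariant sub-σ-algebra of the measure algebra.  (Countable
joins of classes of measurable sets always exist in the measure algebra.) -/
structure Factor (α : BooleanAction G μ) where
  carrier : Set (MeasAlg μ)
  top_mem : ⊤ ∈ carrier
  compl_mem : ∀ A ∈ carrier, Aᶜ ∈ carrier
  countable_sup_mem : ∀ A : ℕ → MeasAlg μ, (∀ n, A n ∈ carrier) →
    ∀ B, IsLUB (Set.range A) B → B ∈ carrier
  invariant : ∀ g : G, ∀ A ∈ carrier, (α g).1 A ∈ carrier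

/-- A factor is trivial if it is the one-point system, i.e. consists only of the classes of null
sets and of sets of full measure. -/
def Factor.IsTrivial {α : BooleanAction G μ} (D : Factor α) : Prop :=
  ∀ A ∈ D.carrier, A = ⊥ ∨ A = ⊤

/-- A spatial action: an action of `G` on `Y` by a jointly Borel map `G × Y → Y`, each element of
`G` preserving `ν`. -/
structure IsSpatialAction (G : Type*) [Group G] [MeasurableSpace G] {Y : Type*}
    [MeasurableSpace Y] [MulAction G Y] (ν : Measure Y) : Prop where
  measurable_smul : Measurable (fun p : G × Y => p.1 • p.2)
  measurePreserving : ∀ g : G, MeasurePreserving (fun y : Y => g • y) ν ν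

/-- The map `[B] ↦ [g B]` on the measure algebra of a spatial action (`g B` is the preimage of `B`
under the action of `g⁻¹`). -/
def IsSpatialAction.translate {G : Type*} [Group G] [MeasurableSpace G] {Y : Type*}
    [MeasurableSpace Y] [MulAction G Y] {ν : Measure Y} (h : IsSpatialAction G ν) (g : G) :
    MeasAlg ν → MeasAlg ν :=
  MeasAlg.comap (fun y : Y => g⁻¹ • y) (h.measurePreserving g⁻¹)

/-- The factor `D` is spatial: there is a spatial `G`-action on a standard Borel probability space
`(Y, ν)` and a measure preserving, `G`-equivariant isomorphism of the measure algebra of `(Y, ν)`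
onto `D`.  (Every standard Borel space is Borel isomorphic to one in `Type`, so the universe of `Y`
is no restriction.) -/
def Factor.IsSpatial [MeasurableSpace G] {α : BooleanAction G μ} (D : Factor α) : Prop :=
  ∃ (Y : Type) (_ : MeasurableSpace Y) (_ : StandardBorelSpace Y) (_ : MulAction G Y)
    (ν : Measure Y) (_ : IsProbabilityMeasure ν) (h : IsSpatialAction G ν)
    (Φ : MeasAlg ν ≃o D.carrier),
    (∀ A : MeasAlg ν, (Φ A : MeasAlg μ).measure = A.measure) ∧
    ∀ (g : G) (A : MeasAlg ν), (Φ (h.translate g A) : MeasAlg μ) = (α g).1 (Φ A : MeasAlg μ)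

end

end Whirly

end

/-!
A boolean action of a Polish group `G` is whirly iff it has no nontrivial spatial factor.

*Spatial factors of whirly actions are trivial.* Whirliness passes to the spatial model `(Y, ν)`.
For a Borel set `C ⊆ Y` and an open `V ⊆ G`, let `M V` be the set of those `y` for which
`g • y ∈ C` for comeagrely many `g ∈ V`; it is measurable (`measurableSet_isMeagre_section`). If
`V' * W ⊆ V`, then `W` maps `M V` into `M V'`, so whirliness forces `M V'` to have full measure as
soon as `M V` has positive measure, and translating `V'` over `G` gives a zero-one law: either almost
every orbit map is comeagrely in `C`, or almost every orbit map is comeagrely outside `C`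
(`IsSpatialAction.ae_isMeagre_or`). Applied to a countable family of Borel sets separating points,
this makes almost every orbit map comeagrely constant, with a common value. A point with such an
orbit map is fixed and equal to this value, so `ν` is a point mass
(`IsSpatialAction.measure_eq_zero_or`). Only the translates of the sets in `G` are used, so no
topological model of the Borel action is needed.

*An action that is not whirly has a nontrivial spatial factor.* Let `A` and `B` have positive
measure, with `A` disjoint from `g B` for all `g` in a neighbourhood `U` of `1`. Let `w` be a bump
function with support in `U`, uniformly continuous for the right uniformity, and smooth the indicator
function of `B` to `f = sup_d w d • 1_{d B}`, the supremum over a countable dense set of `d`. The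
translates of `f`, evaluated at a point `x`, form a function `g ↦ sup {w (g⁻¹ * d) | x ∈ d B}` on `G`
that has, for every `x`, the same modulus of continuity, expressed in terms of `g⁻¹ * g'`. The
functions with this modulus form a compact metrizable space `Modulated m` on which `G` acts
continuously, and the map from `X` to it is equivariant modulo null sets
(`apply_mk_preimage_smoothing`), because by continuity of the action a union over the dense set
represents the join over the whole group (`isLUB_denseUnion`). The resulting factor is spatial, and
it contains the class of `{f > 0}`, which contains `B` and is disjoint from `A`.
-/

open MeasureTheory
open scoped ENNReal Topology symmDiff

namespace Whirly

/-! ### Baire category in the sections of Borel sets -/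

section Category

open TopologicalSpace

/-- Localization of the Baire property: a Borel set that is nonmeagre in an open set `U` is
comeagre in some basic open subset of `U`. -/
theorem exists_mem_countableBasis_isMeagre_diff {G : Type*} [TopologicalSpace G]
    [SecondCountableTopology G] [MeasurableSpace G] [BorelSpace G] {S U : Set G}
    (hS : MeasurableSet S) (hU : IsOpen U) (h : ¬ IsMeagre (U ∩ S)) :
    ∃ V ∈ countableBasis G, V ⊆ U ∧ IsMeagre (V \ S) := by
  obtain ⟨O, hO, e⟩ := hS.residualEq_isOpen
  rw [Filter.eventuallyEq_set] at e
  have h₁ : IsMeagre (O \ S) := by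
    filter_upwards [e] with x hx hx'
    exact hx'.2 (hx.2 hx'.1)
  have h₂ : IsMeagre (S \ O) := by
    filter_upwards [e] with x hx hx'
    exact hx'.2 (hx.1 hx'.1)
  obtain ⟨x, hxU, hxO⟩ : (U ∩ O).Nonempty := by
    by_contra hne
    rw [Set.not_nonempty_iff_eq_empty] at hne
    refine h (h₂.mono ?_)
    exact fun x hx => ⟨hx.2, fun hxO => (hne.le ⟨hx.1, hxO⟩ : x ∈ (∅ : Set G))⟩
  obtain ⟨V, hV, -, hVs⟩ := (isBasis_countableBasis G).exists_subset_of_mem_open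
    (show x ∈ U ∩ O from ⟨hxU, hxO⟩) (hU.inter hO)
  refine ⟨V, hV, fun y hy => (hVs hy).1, h₁.mono ?_⟩
  exact fun y hy => ⟨(hVs hy.1).2, hy.2⟩

variable {G : Type*} [TopologicalSpace G] [SecondCountableTopology G] [BaireSpace G]
  [MeasurableSpace G] [BorelSpace G] {Y : Type*} [MeasurableSpace Y]

/-- The set of points over which the section of a Borel set is meagre in a fixed open set is
measurable (a Vaught transform). The class of sets with this property for all open `U` contains
the rectangles, by the Baire category theorem, and is a σ-algebra: for complements, a Borel set
is meagre in `U` iff its complement is nonmeagre in every basic open subset of `U`. -/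
theorem measurableSet_isMeagre_section {C : Set (G × Y)} (hC : MeasurableSet C) {U : Set G}
    (hU : IsOpen U) : MeasurableSet {y | IsMeagre (U ∩ {g | (g, y) ∈ C})} := by
  have key : ∀ C : Set (G × Y), MeasurableSet C → (∀ U : Set G, IsOpen U →
      MeasurableSet {y | IsMeagre (U ∩ {g | (g, y) ∈ C})}) := by
    have hgen : (Prod.instMeasurableSpace : MeasurableSpace (G × Y)) =
        MeasurableSpace.generateFrom
          (Set.image2 (· ×ˢ ·) {s : Set G | IsOpen s} {t : Set Y | MeasurableSet t}) := by
      have h₁ : MeasurableSpace.generateFrom {s : Set G | IsOpen s} = ‹MeasurableSpace G› :=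
        (BorelSpace.measurable_eq (α := G)).symm
      refine (generateFrom_eq_prod h₁ MeasurableSpace.generateFrom_measurableSet ?_ ?_).symm
      · exact ⟨fun _ => Set.univ, fun _ => isOpen_univ, Set.iUnion_const _⟩
      · exact ⟨fun _ => Set.univ, fun _ => MeasurableSet.univ, Set.iUnion_const _⟩
    intro C hC
    refine MeasurableSpace.induction_on_inter (C := fun C _ => ∀ U : Set G, IsOpen U →
      MeasurableSet {y | IsMeagre (U ∩ {g | (g, y) ∈ C})}) hgen ?_ ?_ ?_ ?_ ?_ C hC
    · rintro _ ⟨s₁, hs₁, t₁, ht₁, rfl⟩ _ ⟨s₂, hs₂, t₂, ht₂, rfl⟩ -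
      exact ⟨s₁ ∩ s₂, IsOpen.inter hs₁ hs₂, t₁ ∩ t₂, MeasurableSet.inter ht₁ ht₂,
        Set.prod_inter_prod.symm⟩
    · intro U _
      simp [IsMeagre.empty]
    · rintro _ ⟨s, hs, t, ht, rfl⟩ U hU
      by_cases hne : (U ∩ s).Nonempty
      · convert MeasurableSet.compl ht using 1
        ext y
        by_cases hy : y ∈ t
        · simpa [hy] using! not_isMeagre_of_isOpen (hU.inter hs) hne
        · simp [hy, IsMeagre.empty]
      · rw [Set.not_nonempty_iff_eq_empty] at hne
        convert MeasurableSet.univ using 1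
        refine Set.eq_univ_of_forall fun y => ?_
        refine IsMeagre.empty.mono ?_
        rw [← hne]
        exact fun g hg => ⟨hg.1, hg.2.1⟩
    · intro C hC ih U hU
      have : {y | IsMeagre (U ∩ {g | (g, y) ∈ Cᶜ})} =
          ⋂ V ∈ {V ∈ countableBasis G | V ⊆ U}, {y | IsMeagre (V ∩ {g | (g, y) ∈ C})}ᶜ := by
        ext y
        simp only [Set.mem_ofPred_eq, Set.mem_iInter, Set.mem_compl_iff]
        constructor
        · rintro h V ⟨hV, hVU⟩ h'
          refine not_isMeagre_of_isOpen (isOpen_of_mem_countableBasis hV)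
            (nonempty_of_mem_countableBasis hV) ((h.union h').mono fun g hg => ?_)
          by_cases hgC : (g, y) ∈ C
          · exact Or.inr ⟨hg, hgC⟩
          · exact Or.inl ⟨hVU hg, hgC⟩
        · intro h
          by_contra hm
          obtain ⟨V, hV, hVU, hVm⟩ := exists_mem_countableBasis_isMeagre_diff
            (measurable_prodMk_right hC.compl) hU hm
          refine h V ⟨hV, hVU⟩ (hVm.mono ?_)
          exact fun g hg => ⟨hg.1, fun h' => h' hg.2⟩
      rw [this]
      exact MeasurableSet.biInter ((countable_countableBasis G).mono fun V hV => hV.1)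
        fun V hV => (ih V (isOpen_of_mem_countableBasis hV.1)).compl
    · intro f _ _ ih U hU
      have : {y | IsMeagre (U ∩ {g | (g, y) ∈ ⋃ i, f i})} =
          ⋂ i, {y | IsMeagre (U ∩ {g | (g, y) ∈ f i})} := by
        ext y
        simp only [Set.mem_ofPred_eq, Set.mem_iInter]
        refine ⟨fun h i => h.mono ?_, fun h => ?_⟩
        · exact fun g hg => ⟨hg.1, Set.mem_iUnion.2 ⟨i, hg.2⟩⟩
        refine (isMeagre_iUnion h).mono fun g hg => ?_
        obtain ⟨i, hi⟩ := Set.mem_iUnion.1 hg.2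
        exact Set.mem_iUnion.2 ⟨i, hg.1, hi⟩
      rw [this]
      exact MeasurableSet.iInter fun i => ih i U hU
  exact key C hC U hU

end Category

/-! ### Whirly spatial actions are trivial -/

section Spatial

open TopologicalSpace

theorem isMeagre_preimage_mul_right {G : Type*} [Group G] [TopologicalSpace G]
    [IsTopologicalGroup G] (h : G) {S : Set G} (hS : IsMeagre S) :
    IsMeagre ((· * h) ⁻¹' S) :=
  hS.preimage_of_isOpenMap (continuous_mul_const h) (isOpenMap_mul_right h)

variable {G : Type*} [Group G] [TopologicalSpace G] [IsTopologicalGroup G] [PolishSpace G]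
  [MeasurableSpace G] [BorelSpace G] {Y : Type*} [MeasurableSpace Y] [MulAction G Y]
  {ν : Measure Y}

/-- Zero-one law for orbits: in a whirly spatial action, for every Borel set `C` either almost
every orbit map `g ↦ g • y` takes values outside `C` up to a meagre set of `g`, or almost every
orbit map takes values in `C` up to a meagre set of `g`. -/
theorem IsSpatialAction.ae_isMeagre_or (h : IsSpatialAction G ν)
    (hw : ∀ A B : Set Y, MeasurableSet A → MeasurableSet B → ν A ≠ 0 → ν B ≠ 0 →
      ∀ U ∈ 𝓝 (1 : G), ∃ g ∈ U, ∃ y ∈ A, g⁻¹ • y ∈ B)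
    {C : Set Y} (hC : MeasurableSet C) :
    (∀ᵐ y ∂ν, IsMeagre {g : G | g • y ∈ C}) ∨ (∀ᵐ y ∂ν, IsMeagre {g : G | g • y ∉ C}) := by
  have : BaireSpace G := by
    let := upgradeIsCompletelyMetrizable G
    infer_instance
  let M : Set G → Set Y := fun V => {y | IsMeagre (V ∩ {g | g • y ∈ Cᶜ})}
  have hM : ∀ V, IsOpen V → MeasurableSet (M V) := fun V hV =>
    measurableSet_isMeagre_section (h.measurable_smul hC.compl) hV
  by_cases hall : ∀ V ∈ countableBasis G, ν (M V) = 0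
  · left
    have h₀ : ∀ᵐ y ∂ν, ∀ V ∈ countableBasis G, y ∉ M V :=
      (ae_ball_iff (countable_countableBasis G)).2 fun V hV => measure_eq_zero_iff_ae_notMem.1
        (hall V hV)
    filter_upwards [h₀] with y hy
    by_contra hm
    obtain ⟨V, hV, -, hVm⟩ := exists_mem_countableBasis_isMeagre_diff
      (S := {g : G | g • y ∈ C}) (U := Set.univ)
      (measurable_prodMk_right (h.measurable_smul hC)) isOpen_univ (by rwa [Set.univ_inter])
    exact hy V hV hVm
  · right
    push Not at hall
    obtain ⟨V, hV, hVpos⟩ := hall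
    obtain ⟨v, hv⟩ := nonempty_of_mem_countableBasis hV
    obtain ⟨V', W, hV', hvV', hW, h1W, hVW⟩ : ∃ V' W : Set G, IsOpen V' ∧ v ∈ V' ∧ IsOpen W ∧
        (1 : G) ∈ W ∧ ∀ a ∈ V', ∀ b ∈ W, a * b ∈ V := by
      have hopen : IsOpen {p : G × G | p.1 * p.2 ∈ V} :=
        (isOpen_of_mem_countableBasis hV).preimage continuous_mul
      obtain ⟨V', W, hV', hW, hv', h1, hs⟩ := isOpen_prod_iff.1 hopen v 1 (by simpa using hv)
      exact ⟨V', W, hV', hv', hW, h1, fun a ha b hb => hs (Set.mk_mem_prod ha hb)⟩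
    -- `W` maps `M V` into `M V'`, so by whirliness the complement of `M V'` is null
    have hfull : ν (M V')ᶜ = 0 := by
      by_contra hne
      obtain ⟨g, hgW, y, hy, hgy⟩ := hw _ _ (hM V' hV').compl
        (hM V (isOpen_of_mem_countableBasis hV)) hne hVpos W (hW.mem_nhds h1W)
      refine hy ?_
      refine (isMeagre_preimage_mul_right g hgy).mono ?_
      rintro k ⟨hk, hkC⟩
      refine ⟨hVW k hk g hgW, ?_⟩
      simpa [mul_smul] using hkC
    have hD : ∀ᵐ y ∂ν, ∀ n, denseSeq G n • y ∈ M V' :=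
      ae_all_iff.2 fun n =>
        (h.measurePreserving (denseSeq G n)).quasiMeasurePreserving.ae (p := fun y => y ∈ M V')
          (measure_eq_zero_iff_ae_notMem.1 hfull |>.mono fun y hy => not_not.1 hy)
    filter_upwards [hD] with y hy
    refine (isMeagre_iUnion fun n =>
      isMeagre_preimage_mul_right (denseSeq G n)⁻¹ (hy n)).mono ?_
    intro k hk
    -- the right translates of `V'` by a dense sequence cover the group
    obtain ⟨_, hd, n, rfl⟩ := (denseRange_denseSeq G).inter_open_nonempty
      {d | k * d⁻¹ ∈ V'} (hV'.preimage (by fun_prop)) ⟨v⁻¹ * k, by simpa using hvV'⟩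
    refine Set.mem_iUnion.2 ⟨n, hd, ?_⟩
    simpa [← mul_smul] using hk

/-- A whirly spatial action lives on a single fixed point. By the zero-one law, applied to a
sequence of Borel sets separating points, almost every orbit map is constant up to a meagre set,
with the same constant `p`. Two translates of a comeagre set meet, so `y` is fixed by the group,
and hence `y = p`. -/
theorem IsSpatialAction.measure_eq_zero_or [StandardBorelSpace Y] (h : IsSpatialAction G ν)
    (hw : ∀ A B : Set Y, MeasurableSet A → MeasurableSet B → ν A ≠ 0 → ν B ≠ 0 →
      ∀ U ∈ 𝓝 (1 : G), ∃ g ∈ U, ∃ y ∈ A, g⁻¹ • y ∈ B)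
    (C : Set Y) : ν C = 0 ∨ ν Cᶜ = 0 := by
  have : BaireSpace G := by
    let := upgradeIsCompletelyMetrizable G
    infer_instance
  obtain ⟨c, hcm, hcs⟩ := exists_seq_separating Y (p := MeasurableSet) MeasurableSet.univ Set.univ
  have hE : ∀ n, ∃ E : Set Y, (E = c n ∨ E = (c n)ᶜ) ∧ ∀ᵐ y ∂ν, IsMeagre {g : G | g • y ∉ E} := by
    intro n
    rcases h.ae_isMeagre_or hw (hcm n) with h' | h'
    · exact ⟨(c n)ᶜ, Or.inr rfl, by simpa using! h'⟩
    · exact ⟨c n, Or.inl rfl, h'⟩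
  choose E hEc hEm using hE
  have hsub : (⋂ n, E n).Subsingleton := by
    intro x hx y hy
    refine hcs x trivial y trivial fun n => ?_
    have hx' := Set.mem_iInter.1 hx n
    have hy' := Set.mem_iInter.1 hy n
    rcases hEc n with e | e <;> rw [e] at hx' hy'
    · exact iff_of_true hx' hy'
    · exact iff_of_false hx' hy'
  have hmem : ∀ᵐ y ∂ν, y ∈ ⋂ n, E n := by
    filter_upwards [ae_all_iff.2 hEm] with y hy
    have hm : IsMeagre {g : G | g • y ∉ ⋂ n, E n} := by
      refine (isMeagre_iUnion hy).mono fun g hg => ?_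
      simpa using hg
    have hmeet : ∀ k : G, ∃ g : G, g • y ∈ ⋂ n, E n ∧ g • k • y ∈ ⋂ n, E n := by
      intro k
      by_contra hne
      push Not at hne
      refine not_isMeagre_of_isOpen (isOpen_univ (X := G)) Set.univ_nonempty
        ((hm.union (isMeagre_preimage_mul_right k hm)).mono fun g _ => ?_)
      by_cases hg : g • y ∈ ⋂ n, E n
      · refine Or.inr ?_
        have := hne g hg
        rwa [← mul_smul] at this
      · exact Or.inl hg
    have hfix : ∀ k : G, k • y = y := fun k => by
      obtain ⟨g, hg₁, hg₂⟩ := hmeet k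
      exact (MulAction.injective g (hsub hg₁ hg₂)).symm
    obtain ⟨g, hg, -⟩ := hmeet 1
    rwa [hfix g] at hg
  by_cases hne : (C ∩ ⋂ n, E n).Nonempty
  · right
    obtain ⟨p, hpC, hp⟩ := hne
    rw [measure_eq_zero_iff_ae_notMem]
    filter_upwards [hmem] with y hy hyC
    exact hyC (hsub hp hy ▸ hpC)
  · left
    rw [measure_eq_zero_iff_ae_notMem]
    filter_upwards [hmem] with y hy hyC
    exact hne ⟨y, hyC, hy⟩

end Spatial

/-! ### The measure algebra -/

namespace MeasAlg

variable {X : Type*} [MeasurableSpace X] {μ : Measure X}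

theorem mk_le_mk {A B : Set X} {hA : MeasurableSet A} {hB : MeasurableSet B} :
    mk μ A hA ≤ mk μ B hB ↔ A ≤ᵐ[μ] B := Iff.rfl

theorem measure_mk {A : Set X} {hA : MeasurableSet A} : (mk μ A hA).measure = μ A := rfl

theorem measure_mono {a b : MeasAlg μ} (h : a ≤ b) : a.measure ≤ b.measure := by
  induction a using ind with | h A hA => ?_
  induction b using ind with | h B hB => ?_
  exact measure_mono_ae h

theorem measure_eq_zero_iff {a : MeasAlg μ} : a.measure = 0 ↔ a = ⊥ := by
  induction a using ind with | h A hA => ?_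
  exact ae_eq_empty.symm.trans (mk_eq_mk (hB := MeasurableSet.empty)).symm

theorem isLUB_mk_iUnion {ι : Type*} [Countable ι] (s : ι → Set X) (hs : ∀ i, MeasurableSet (s i)) :
    IsLUB (Set.range fun i => mk μ (s i) (hs i)) (mk μ (⋃ i, s i) (MeasurableSet.iUnion hs)) := by
  constructor
  · rintro _ ⟨i, rfl⟩
    exact mk_le_mk.2 (Set.subset_iUnion s i).eventuallyLE
  · intro b hb
    induction b using ind with | h B hB => ?_
    have h : ∀ᵐ x ∂μ, ∀ i, x ∈ s i → x ∈ B := ae_all_iff.2 fun i => mk_le_mk.1 (hb ⟨i, rfl⟩)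
    refine mk_le_mk.2 ?_
    filter_upwards [h] with x hx hxs
    obtain ⟨i, hi⟩ := Set.mem_iUnion.1 hxs
    exact hx i hi

theorem isClosed_Iic (b : MeasAlg μ) : IsClosed (Set.Iic b) := by
  refine isClosed_of_closure_subset fun a ha => ?_
  induction a using ind with | h A hA => ?_
  induction b using ind with | h B hB => ?_
  rw [Set.mem_Iic, mk_le_mk, ae_le_set]
  refine le_antisymm (le_of_forall_gt fun ε hε => ?_) zero_le
  obtain ⟨c, hc, hac⟩ := EMetric.mem_closure_iff.1 ha ε hε
  induction c using ind with | h C hC => ?_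
  refine lt_of_le_of_lt ?_ hac
  -- `A \ B` is contained in `A ∆ C` up to a null set because `C ⊆ B` up to a null set
  refine measure_mono_ae ?_
  filter_upwards [mk_le_mk.1 hc] with x hx hxAB
  exact Or.inl ⟨hxAB.1, fun hxC => hxAB.2 (hx hxC)⟩

end MeasAlg

/-! ### Spatial factors of whirly actions -/

section

variable {G : Type*} [Group G] [TopologicalSpace G] {X : Type*} [MeasurableSpace X] {μ : Measure X}
  {α : BooleanAction G μ}

theorem Factor.inf_mem (D : Factor α) {A B : MeasAlg μ} (hA : A ∈ D.carrier) (hB : B ∈ D.carrier) :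
    A ⊓ B ∈ D.carrier := by
  have hsup : Aᶜ ⊔ Bᶜ ∈ D.carrier := by
    refine D.countable_sup_mem (fun n => if n = 0 then Aᶜ else Bᶜ) (fun n => ?_) _ ?_
    · split_ifs
      exacts [D.compl_mem A hA, D.compl_mem B hB]
    · convert isLUB_pair (a := Aᶜ) (b := Bᶜ) using 1
      ext c
      constructor
      · rintro ⟨n, rfl⟩
        dsimp only
        split_ifs <;> simp
      · rintro (rfl | rfl)
        exacts [⟨0, rfl⟩, ⟨1, rfl⟩]
  simpa using D.compl_mem _ hsup

/-- Whirliness passes to the spatial model of a factor: an intersection of positive measure in the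
factor corresponds to one in the model, as factors are closed under intersections. So the model is
a whirly spatial action, whose sets are null or conull. -/
theorem IsWhirly.isTrivial_of_isSpatial [IsTopologicalGroup G] [PolishSpace G] [MeasurableSpace G]
    [BorelSpace G] (hα : IsWhirly α) {D : Factor α} (hD : D.IsSpatial) : D.IsTrivial := by
  obtain ⟨Y, _, _, _, ν, _, h, Φ, hΦ, hΦg⟩ := hD
  have hw : ∀ A B : Set Y, MeasurableSet A → MeasurableSet B → ν A ≠ 0 → ν B ≠ 0 →
      ∀ U ∈ 𝓝 (1 : G), ∃ g ∈ U, ∃ y ∈ A, g⁻¹ • y ∈ B := by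
    intro A B hA hB hA0 hB0 U hU
    set a := MeasAlg.mk ν A hA
    set b := MeasAlg.mk ν B hB
    obtain ⟨g, hgU, hg⟩ := hα (Φ a) (Φ b) (by rw [hΦ]; exact pos_iff_ne_zero.2 hA0)
      (by rw [hΦ]; exact pos_iff_ne_zero.2 hB0) U hU
    have hmem : (Φ a : MeasAlg μ) ⊓ (α g).1 (Φ b) ∈ D.carrier :=
      D.inf_mem (Φ a).2 (D.invariant g _ (Φ b).2)
    obtain ⟨c, hc⟩ := Φ.surjective ⟨_, hmem⟩
    have hca : c ≤ a := by
      rw [← Φ.le_iff_le, hc]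
      exact inf_le_left (a := (Φ a : MeasAlg μ))
    have hcb : c ≤ h.translate g b := by
      rw [← Φ.le_iff_le, hc, ← Subtype.coe_le_coe, hΦg]
      exact inf_le_right
    have hc0 : 0 < c.measure := by
      rw [← hΦ, hc]
      exact hg
    have h0 : 0 < (a ⊓ h.translate g b).measure :=
      hc0.trans_le (MeasAlg.measure_mono (le_inf hca hcb))
    obtain ⟨y, hyA, hyB⟩ := nonempty_of_measure_ne_zero
      (show ν (A ∩ (fun y => g⁻¹ • y) ⁻¹' B) ≠ 0 from h0.ne')
    exact ⟨g, hgU, y, hyA, hyB⟩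
  intro A hA
  obtain ⟨c, hc⟩ := Φ.surjective ⟨A, hA⟩
  have hAc : A.measure = c.measure := by rw [← hΦ, hc]
  obtain ⟨c', hc'⟩ := Φ.surjective ⟨Aᶜ, D.compl_mem A hA⟩
  have hAc' : Aᶜ.measure = c'.measure := by rw [← hΦ, hc']
  induction c using MeasAlg.ind with | h C hC => ?_
  rcases h.measure_eq_zero_or hw C with h0 | h0
  · exact Or.inl (MeasAlg.measure_eq_zero_iff.1 (hAc.trans h0))
  · right
    -- `c'` is disjoint from `[C] = ⊤`
    have htop : MeasAlg.mk ν C hC = ⊤ := (MeasAlg.mk_eq_mk (hB := MeasurableSet.univ)).2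
      (Filter.eventuallyEq_univ.2 h0)
    have hle : (⟨Aᶜ, D.compl_mem A hA⟩ : D.carrier) ≤ ⟨A, hA⟩ := by
      rw [← hc, ← hc', htop, Φ.le_iff_le]
      exact le_top
    exact compl_le_self.1 hle

end

/-! ### The compact space of functions with a given modulus of continuity -/

section Bump

/-- A neighbourhood of the identity in a first countable group supports a function that is
positive at `1` and uniformly continuous for the right uniformity. -/
theorem exists_uniform_bump {G : Type*} [Group G] [TopologicalSpace G] [IsTopologicalGroup G]
    [FirstCountableTopology G] {U : Set G} (hU : U ∈ 𝓝 (1 : G)) :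
    ∃ w : G → ℝ≥0∞, Continuous w ∧ 0 < w 1 ∧ (∀ k, 0 < w k → k ∈ U) ∧
      ∀ ε > 0, ∀ᶠ u in 𝓝 (1 : G), ∀ k, w (u * k) ≤ w k + ε := by
  let := IsTopologicalGroup.rightUniformSpace G
  have hunif : uniformity G = Filter.comap (fun p : G × G => p.2 * p.1⁻¹) (𝓝 (1 : G)) := rfl
  have : (uniformity G).IsCountablyGenerated := by
    rw [hunif]
    infer_instance
  let := UniformSpace.pseudoMetricSpace G
  obtain ⟨r, hr, hrU⟩ := EMetric.mem_nhds_iff.1 hU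
  -- subtraction from a finite constant is continuous on `[0, ∞]`
  obtain ⟨r', hr'0, hr'⟩ : ∃ r' : ℝ≥0∞, 0 < r' ∧ r' ≤ r ∧ r' ≠ ∞ :=
    ⟨min r 1, by positivity, min_le_left _ _, ne_top_of_le_ne_top (by simp) (min_le_right r 1)⟩
  refine ⟨fun k => r' - edist k 1, ?_, by simpa using hr'0, fun k hk => ?_, fun ε hε => ?_⟩
  · exact (ENNReal.continuous_sub_left hr'.2).comp (by fun_prop)
  · exact hrU ((tsub_pos_iff_lt.1 hk).trans_le hr'.1)
  · have hmem : {p : G × G | edist p.1 p.2 < ε} ∈ uniformity G := edist_mem_uniformity hε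
    rw [hunif] at hmem
    obtain ⟨V, hV, hVs⟩ := Filter.mem_comap.1 hmem
    filter_upwards [hV] with u hu k
    have hd : edist k (u * k) < ε := 
      hVs (a := (k, u * k)) (show (u * k) * k⁻¹ ∈ V by simpa using hu)
    rw [tsub_le_iff_right]
    calc r' ≤ r' - edist k 1 + edist k 1 := le_tsub_add
      _ ≤ r' - edist k 1 + (ε + edist (u * k) 1) := by
          gcongr
          exact (edist_triangle k (u * k) 1).trans (by gcongr)
      _ = r' - edist k 1 + ε + edist (u * k) 1 := (add_assoc _ _ _).symm

end Bump

/-- The functions `φ : G → [0, ∞]` with `φ g ≤ φ g' + m (g⁻¹ * g')` for all `g, g'`. As the bound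
depends on `g⁻¹ * g'` only, this set of functions is invariant under left translations. -/
def Modulated {G : Type*} [Group G] (m : G → ℝ≥0∞) : Type _ :=
  {φ : G → ℝ≥0∞ // ∀ g g', φ g ≤ φ g' + m (g⁻¹ * g')}

namespace Modulated

variable {G : Type*} [Group G] {m : G → ℝ≥0∞}

instance : MulAction G (Modulated m) where
  smul h φ := ⟨fun g => φ.1 (h⁻¹ * g), fun g g' => by
    simpa [mul_assoc] using φ.2 (h⁻¹ * g) (h⁻¹ * g')⟩
  one_smul φ := Subtype.ext (funext fun g => congrArg φ.1 (by simp))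
  mul_smul a b φ := Subtype.ext (funext fun g => congrArg φ.1 (by simp [mul_assoc]))

/-- The topology of pointwise convergence. -/
instance : TopologicalSpace (Modulated m) := inferInstanceAs (TopologicalSpace (Subtype _))

instance : MeasurableSpace (Modulated m) := borel _

instance : BorelSpace (Modulated m) := ⟨rfl⟩

instance : T2Space (Modulated m) := inferInstanceAs (T2Space (Subtype _))

instance : CompactSpace (Modulated m) := by
  have : {φ : G → ℝ≥0∞ | ∀ g g', φ g ≤ φ g' + m (g⁻¹ * g')} =
      ⋂ (g : G) (g' : G), {φ | φ g ≤ φ g' + m (g⁻¹ * g')} := by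
    ext φ
    simp
  have hc : IsClosed {φ : G → ℝ≥0∞ | ∀ g g', φ g ≤ φ g' + m (g⁻¹ * g')} := by
    rw [this]
    exact isClosed_iInter fun g => isClosed_iInter fun g' =>
      isClosed_le (continuous_apply g) ((continuous_apply g').add continuous_const)
  exact isCompact_iff_compactSpace.1 hc.isCompact

variable [TopologicalSpace G]

/-- Evaluation is jointly continuous, because the functions are equicontinuous. -/
theorem continuous_eval [IsTopologicalGroup G] (hm : Filter.Tendsto m (𝓝 1) (𝓝 0)) :
    Continuous fun p : G × Modulated m => p.2.1 p.1 := by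
  refine continuous_iff_continuousAt.2 fun ⟨g, φ⟩ => ?_
  have hφ : Filter.Tendsto (fun p : G × Modulated m => p.2.1 g) (𝓝 (g, φ)) (𝓝 (φ.1 g)) :=
    ((continuous_apply g).comp (continuous_subtype_val.comp continuous_snd)).tendsto (g, φ)
  have h₁ : Filter.Tendsto (fun p : G × Modulated m => m (p.1⁻¹ * g)) (𝓝 (g, φ)) (𝓝 0) := by
    refine hm.comp ?_
    have : Continuous fun p : G × Modulated m => p.1⁻¹ * g := by fun_prop
    simpa using this.tendsto (g, φ)
  have h₂ : Filter.Tendsto (fun p : G × Modulated m => m (g⁻¹ * p.1)) (𝓝 (g, φ)) (𝓝 0) := by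
    refine hm.comp ?_
    have : Continuous fun p : G × Modulated m => g⁻¹ * p.1 := by fun_prop
    simpa using this.tendsto (g, φ)
  refine tendsto_of_tendsto_of_tendsto_of_le_of_le
    (by simpa using ENNReal.Tendsto.sub hφ h₂ (Or.inr ENNReal.zero_ne_top))
    (by simpa using hφ.add h₁) (fun p => ?_) (fun p => p.2.2 p.1 g)
  exact tsub_le_iff_right.2 (p.2.2 g p.1)

theorem continuous_smul [IsTopologicalGroup G] (hm : Filter.Tendsto m (𝓝 1) (𝓝 0)) :
    Continuous fun p : G × Modulated m => p.1 • p.2 := by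
  refine continuous_induced_rng.2 (continuous_pi fun g => ?_)
  exact (continuous_eval hm).comp (by fun_prop : Continuous fun p : G × Modulated m =>
    (p.1⁻¹ * g, p.2))

theorem isClosedEmbedding_restrict [IsTopologicalGroup G] [TopologicalSpace.SeparableSpace G]
    (hm : Filter.Tendsto m (𝓝 1) (𝓝 0)) :
    Topology.IsClosedEmbedding
      fun (φ : Modulated m) (n : ℕ) => φ.1 (TopologicalSpace.denseSeq G n) := by
  refine Continuous.isClosedEmbedding (continuous_pi fun n =>
    (continuous_apply _).comp continuous_subtype_val) fun φ ψ h => ?_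
  have hc : ∀ φ : Modulated m, Continuous φ.1 := fun φ =>
    (continuous_eval hm).comp (by fun_prop : Continuous fun g : G => (g, φ))
  exact Subtype.ext ((TopologicalSpace.denseRange_denseSeq G).equalizer (hc φ) (hc ψ) h)

theorem polishSpace [IsTopologicalGroup G] [TopologicalSpace.SeparableSpace G]
    (hm : Filter.Tendsto m (𝓝 1) (𝓝 0)) : PolishSpace (Modulated m) :=
  (isClosedEmbedding_restrict hm).polishSpace

end Modulated

/-! ### Spatial factors from equivariant maps -/

section

variable {G : Type*} [Group G] [TopologicalSpace G] [MeasurableSpace G] {X : Type*}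
  [MeasurableSpace X] {μ : Measure X} [IsProbabilityMeasure μ]

/-- A measurable map from `X` to a standard Borel `G`-space that is equivariant modulo null sets
makes the preimages of Borel sets a spatial factor. -/
theorem exists_isSpatial_of_map {α : BooleanAction G μ} {Y : Type} [MeasurableSpace Y]
    [StandardBorelSpace Y] [MulAction G Y] (hsmul : Measurable fun p : G × Y => p.1 • p.2)
    {π : X → Y} (hπ : Measurable π)
    (hα : ∀ (g : G) (C : Set Y) (hC : MeasurableSet C) (hC' : MeasurableSet ((g⁻¹ • ·) ⁻¹' C)),
      (α g).1 (MeasAlg.mk μ (π ⁻¹' C) (hπ hC)) = MeasAlg.mk μ (π ⁻¹' ((g⁻¹ • ·) ⁻¹' C)) (hπ hC')) :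
    ∃ D : Factor α, D.IsSpatial ∧
      ∀ (C : Set Y) (hC : MeasurableSet C), MeasAlg.mk μ (π ⁻¹' C) (hπ hC) ∈ D.carrier := by
  have hg : ∀ g : G, Measurable fun y : Y => g • y := fun g =>
    hsmul.comp measurable_prodMk_left
  have hmp : MeasurePreserving π μ (μ.map π) := hπ.measurePreserving μ
  let D : Factor α :=
    { carrier := {A | ∃ (C : Set Y) (hC : MeasurableSet C), MeasAlg.mk μ (π ⁻¹' C) (hπ hC) = A}
      top_mem := ⟨Set.univ, MeasurableSet.univ, rfl⟩
      compl_mem := by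
        rintro _ ⟨C, hC, rfl⟩
        exact ⟨Cᶜ, hC.compl, rfl⟩
      countable_sup_mem := by
        intro A hA B hB
        choose C hC hCA using hA
        have hl := MeasAlg.isLUB_mk_iUnion (μ := μ) (fun n => π ⁻¹' C n) (fun n => hπ (hC n))
        simp only [hCA] at hl
        exact ⟨⋃ n, C n, MeasurableSet.iUnion hC,
          (MeasAlg.mk_eq_mk.2 (Filter.EventuallyEq.of_eq Set.preimage_iUnion)).trans
            (hl.unique hB)⟩
      invariant := by
        rintro g _ ⟨C, hC, rfl⟩
        exact ⟨_, hg g⁻¹ hC, (hα g C hC (hg g⁻¹ hC)).symm⟩ }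
  refine ⟨D, ?_, fun C hC => ⟨C, hC, rfl⟩⟩
  have hsp : IsSpatialAction G (μ.map π) := by
    refine ⟨hsmul, fun g => ⟨hg g, Measure.ext fun C hC => ?_⟩⟩
    rw [Measure.map_apply (hg g) hC, Measure.map_apply hπ (hg g hC), Measure.map_apply hπ hC]
    have h := (α g⁻¹).2 (MeasAlg.mk μ (π ⁻¹' C) (hπ hC))
    rw [hα g⁻¹ C hC (hg _ hC)] at h
    simpa [MeasAlg.measure_mk] using h
  have hcomap : ∀ (C : Set Y) (hC : MeasurableSet C),
      MeasAlg.comap π hmp (MeasAlg.mk _ C hC) = MeasAlg.mk μ (π ⁻¹' C) (hπ hC) :=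
    fun _ _ => rfl
  have hle : ∀ a b, MeasAlg.comap π hmp a ≤ MeasAlg.comap π hmp b ↔ a ≤ b := by
    intro a b
    induction a using MeasAlg.ind with | h A hA => ?_
    induction b using MeasAlg.ind with | h B hB => ?_
    rw [hcomap, hcomap, MeasAlg.mk_le_mk, MeasAlg.mk_le_mk, ae_le_set, ae_le_set,
      Measure.map_apply hπ (hA.diff hB), Set.preimage_sdiff]
  let Ψ : MeasAlg (μ.map π) ↪o D.carrier :=
    OrderEmbedding.ofMapLEIff (fun a => ⟨MeasAlg.comap π hmp a, by
      induction a using MeasAlg.ind with | h A hA => ?_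
      exact ⟨A, hA, rfl⟩⟩) fun a b => hle a b
  have hΨ : Function.Surjective Ψ := by
    rintro ⟨_, C, hC, rfl⟩
    exact ⟨MeasAlg.mk _ C hC, rfl⟩
  refine ⟨Y, _, inferInstance, _, μ.map π, Measure.isProbabilityMeasure_map hπ.aemeasurable, hsp,
    RelIso.ofSurjective Ψ hΨ, fun a => ?_, fun g a => ?_⟩
  · induction a using MeasAlg.ind with | h A hA => ?_
    exact (Measure.map_apply hπ hA).symm
  · induction a using MeasAlg.ind with | h A hA => ?_
    exact (hα g A hA (hg g⁻¹ hA)).symm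

end

/-! ### A nontrivial spatial factor of an action that is not whirly -/

section

open TopologicalSpace

variable {G : Type*} [Group G] [TopologicalSpace G] [SeparableSpace G] {X : Type*}

/-- The union of those sets `b n` for which the `n`-th term of the dense sequence of `G` is in `O`.
When `b n` represents the translate of a fixed class by the `n`-th term, this represents the join of
all translates by elements of the open set `O`; see `isLUB_denseUnion`. -/
def denseUnion (b : ℕ → Set X) (O : Set G) : Set X :=
  ⋃ n ∈ {n | denseSeq G n ∈ O}, b n

theorem mem_denseUnion {b : ℕ → Set X} {O : Set G} {x : X} :
    x ∈ denseUnion b O ↔ ∃ n, denseSeq G n ∈ O ∧ x ∈ b n := by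
  simp [denseUnion]

variable [MeasurableSpace X] {μ : Measure X}

theorem measurableSet_denseUnion {b : ℕ → Set X} (hb : ∀ n, MeasurableSet (b n)) (O : Set G) :
    MeasurableSet (denseUnion b O) :=
  MeasurableSet.biUnion (Set.to_countable _) fun n _ => hb n

variable {α : BooleanAction G μ} {B : MeasAlg μ} {b : ℕ → Set X} (hb : ∀ n, MeasurableSet (b n))
  (hbα : ∀ n, MeasAlg.mk μ (b n) (hb n) = (α (denseSeq G n)).1 B)
include hbα

/-- By continuity of the action, the countable union over the dense sequence is the join of the
translates by all elements of an open set. -/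
theorem isLUB_denseUnion {O : Set G} (hO : IsOpen O) :
    IsLUB ((fun g => (α g).1 B) '' O)
      (MeasAlg.mk μ (denseUnion b O) (measurableSet_denseUnion hb O)) := by
  constructor
  · rintro _ ⟨g, hg, rfl⟩
    have hcont : Continuous fun g => (α g).1 B :=
      (continuous_apply B).comp ((continuous_induced_dom
        (f := fun (T : Aut μ) (A : MeasAlg μ) => T.1 A)).comp α.continuous_toFun)
    have hclosed := (MeasAlg.isClosed_Iic
      (MeasAlg.mk μ (denseUnion b O) (measurableSet_denseUnion hb O))).preimage hcont
    have hsub : O ∩ Set.range (denseSeq G) ⊆ (fun g => (α g).1 B) ⁻¹'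
        Set.Iic (MeasAlg.mk μ (denseUnion b O) (measurableSet_denseUnion hb O)) := by
      rintro _ ⟨hn, n, rfl⟩
      rw [Set.mem_preimage, ← hbα n]
      exact MeasAlg.mk_le_mk.2 (LE.le.eventuallyLE fun x hx =>
        mem_denseUnion.2 ⟨n, hn, hx⟩)
    exact closure_minimal hsub hclosed ((denseRange_denseSeq G).open_subset_closure_inter hO hg)
  · intro T hT
    induction T using MeasAlg.ind with | h T hTm => ?_
    have h : ∀ᵐ x ∂μ, ∀ n, denseSeq G n ∈ O → x ∈ b n → x ∈ T := by
      refine ae_all_iff.2 fun n => ?_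
      by_cases hn : denseSeq G n ∈ O
      · have := hT ⟨_, hn, rfl⟩
        dsimp only at this
        rw [← hbα n, MeasAlg.mk_le_mk] at this
        filter_upwards [this] with x hx _ using hx
      · exact Filter.Eventually.of_forall fun x hx => absurd hx hn
    refine MeasAlg.mk_le_mk.2 ?_
    filter_upwards [h] with x hx hxs
    obtain ⟨n, hn, hxn⟩ := mem_denseUnion.1 hxs
    exact hx n hn hxn

/-- The action permutes the joins `⋁ {g B | g ∈ O}` over open sets `O`. It need not permute the
dense sequence; `isLUB_denseUnion` makes this immaterial. -/
theorem apply_mk_denseUnion [IsTopologicalGroup G] (h : G) {O : Set G} (hO : IsOpen O) :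
    (α h).1 (MeasAlg.mk μ (denseUnion b O) (measurableSet_denseUnion hb O)) =
      MeasAlg.mk μ (denseUnion b ((h⁻¹ * ·) ⁻¹' O)) (measurableSet_denseUnion hb _) := by
  refine IsLUB.unique ?_ (isLUB_denseUnion hb hbα (hO.preimage (continuous_const_mul h⁻¹)))
  have himage : (fun g => (α g).1 B) '' ((h⁻¹ * ·) ⁻¹' O) =
      (α h).1 '' ((fun g => (α g).1 B) '' O) := by
    have hmul : ∀ g, (α (h * g)).1 B = (α h).1 ((α g).1 B) := fun g => by
      rw [map_mul]
      rfl
    ext A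
    constructor
    · rintro ⟨g, hg, rfl⟩
      exact ⟨_, ⟨h⁻¹ * g, hg, rfl⟩, by rw [← hmul, mul_inv_cancel_left]⟩
    · rintro ⟨_, ⟨g, hg, rfl⟩, rfl⟩
      exact ⟨h * g, by simpa using hg, hmul g⟩
  rw [himage, OrderIso.isLUB_image']
  exact isLUB_denseUnion hb hbα hO

end

section

open TopologicalSpace

variable {G : Type*} [Group G] [TopologicalSpace G] {X : Type*}

/-- A function uniformly continuous for the right uniformity has a modulus of continuity `m`. -/
theorem exists_modulus {w : G → ℝ≥0∞}
    (hw : ∀ ε > 0, ∀ᶠ u in 𝓝 (1 : G), ∀ k, w (u * k) ≤ w k + ε) :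
    ∃ m : G → ℝ≥0∞, Filter.Tendsto m (𝓝 1) (𝓝 0) ∧ ∀ u k, w (u * k) ≤ w k + m u := by
  refine ⟨fun u => ⨆ k, (w (u * k) - w k), ENNReal.tendsto_nhds_zero.2 fun ε hε => ?_,
    fun u k => ?_⟩
  · filter_upwards [hw ε hε] with u hu
    exact iSup_le fun k => tsub_le_iff_left.2 (hu k)
  · exact tsub_le_iff_left.1 (le_iSup (fun k => w (u * k) - w k) k)

/-- The function `g ↦ sup {w (g⁻¹ * d) | x ∈ d B}`, where `d` runs over a dense sequence and `b n`
represents the translate of `B` by its `n`-th term. As a function of `x`, its value at `g` is the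
translate by `g` of the smoothed indicator function `sup_d w d • 1_{d B}`. -/
noncomputable def smoothing [SeparableSpace G] {m w : G → ℝ≥0∞} (hmw : ∀ u k, w (u * k) ≤ w k + m u)
    (b : ℕ → Set X) (x : X) : Modulated m :=
  ⟨fun g => ⨆ n ∈ {n | x ∈ b n}, w (g⁻¹ * denseSeq G n), fun g g' => by
    refine iSup₂_le fun n hn => ?_
    calc w (g⁻¹ * denseSeq G n) = w (g⁻¹ * g' * (g'⁻¹ * denseSeq G n)) := by
          congr 1
          group
      _ ≤ w (g'⁻¹ * denseSeq G n) + m (g⁻¹ * g') := hmw _ _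
      _ ≤ _ := by
          gcongr
          exact le_iSup₂ (f := fun n (_ : n ∈ {n | x ∈ b n}) => w (g'⁻¹ * denseSeq G n)) n hn⟩

theorem lt_smoothing_iff [SeparableSpace G] {m w : G → ℝ≥0∞}
    (hmw : ∀ u k, w (u * k) ≤ w k + m u) (b : ℕ → Set X) (x : X) (g : G) (t : ℝ≥0∞) :
    t < (smoothing hmw b x).1 g ↔ x ∈ denseUnion b {k | t < w (g⁻¹ * k)} := by
  simp only [smoothing, lt_iSup_iff, mem_denseUnion]
  exact exists_congr fun n => ⟨fun ⟨h₁, h₂⟩ => ⟨h₂, h₁⟩, fun ⟨h₁, h₂⟩ => ⟨h₂, h₁⟩⟩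

variable [IsTopologicalGroup G] [PolishSpace G] [MeasurableSpace X]
  {μ : Measure X} {α : BooleanAction G μ} {B : MeasAlg μ} {b : ℕ → Set X}
  (hb : ∀ n, MeasurableSet (b n))
  {m w : G → ℝ≥0∞} (hm : Filter.Tendsto m (𝓝 1) (𝓝 0)) (hmw : ∀ u k, w (u * k) ≤ w k + m u)

include hb hm in
theorem measurable_smoothing : Measurable (smoothing hmw b) := by
  rw [← (Modulated.isClosedEmbedding_restrict hm).measurableEmbedding.measurable_comp_iff]
  refine measurable_pi_iff.2 fun n => measurable_of_Ioi fun t => ?_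
  convert measurableSet_denseUnion hb {k | t < w ((denseSeq G n)⁻¹ * k)} using 1
  ext x
  exact lt_smoothing_iff hmw b x _ t

/-- Equivariance modulo null sets of the smoothing map. The Borel sets for which it holds form a
σ-algebra, and the preimage of `{φ | t < φ g}` is the join of the translates of `B` by the elements
of an open set, which the action permutes. -/
theorem apply_mk_preimage_smoothing (hw : Continuous w)
    (hbα : ∀ n, MeasAlg.mk μ (b n) (hb n) = (α (denseSeq G n)).1 B) (h : G)
    (C : Set (Modulated m)) (hC : MeasurableSet C) (hC' : MeasurableSet ((h⁻¹ • ·) ⁻¹' C)) :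
    (α h).1 (MeasAlg.mk μ (smoothing hmw b ⁻¹' C) (measurable_smoothing hb hm hmw hC)) =
      MeasAlg.mk μ (smoothing hmw b ⁻¹' ((h⁻¹ • ·) ⁻¹' C))
        (measurable_smoothing hb hm hmw hC') := by
  have hinj := (Modulated.isClosedEmbedding_restrict hm).injective
  have hCr :=
    (Modulated.isClosedEmbedding_restrict hm).measurableEmbedding.measurableSet_image.2 hC
  let P : Set (Modulated m) → Prop := fun C =>
    ∃ (h₁ : MeasurableSet (smoothing hmw b ⁻¹' C))
      (h₂ : MeasurableSet (smoothing hmw b ⁻¹' ((h⁻¹ • ·) ⁻¹' C))),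
      (α h).1 (MeasAlg.mk μ _ h₁) = MeasAlg.mk μ _ h₂
  let M : MeasurableSpace (Modulated m) :=
    { MeasurableSet' := P
      measurableSet_empty := ⟨MeasurableSet.empty, MeasurableSet.empty, map_bot (α h).1⟩
      measurableSet_compl := by
        rintro C ⟨h₁, h₂, e⟩
        refine ⟨h₁.compl, h₂.compl, ?_⟩
        have := map_compl (α h).1 (MeasAlg.mk μ _ h₁)
        rw [e] at this
        exact this
      measurableSet_iUnion := by
        intro C hC
        choose h₁ h₂ e using hC
        have e₁ : smoothing hmw b ⁻¹' (⋃ n, C n) = ⋃ n, smoothing hmw b ⁻¹' C n :=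
          Set.preimage_iUnion
        have e₂ : smoothing hmw b ⁻¹' ((h⁻¹ • ·) ⁻¹' (⋃ n, C n)) =
            ⋃ n, smoothing hmw b ⁻¹' ((h⁻¹ • ·) ⁻¹' C n) := by
          rw [Set.preimage_iUnion, Set.preimage_iUnion]
        refine ⟨e₁ ▸ MeasurableSet.iUnion h₁, e₂ ▸ MeasurableSet.iUnion h₂, ?_⟩
        have l₁ := (OrderIso.isLUB_image' (α h).1).2 (MeasAlg.isLUB_mk_iUnion (μ := μ) _ h₁)
        have l₂ := MeasAlg.isLUB_mk_iUnion (μ := μ) _ h₂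
        rw [← Set.range_comp] at l₁
        have := IsLUB.unique l₁ (by convert l₂ using 2; exact funext fun n => e n)
        refine Eq.trans ?_ (this.trans ?_)
        · exact congrArg _ (MeasAlg.mk_eq_mk.2 (Filter.EventuallyEq.of_eq e₁))
        · exact MeasAlg.mk_eq_mk.2 (Filter.EventuallyEq.of_eq e₂.symm) }
  have heval : ∀ g : G, @Measurable _ _ M _ fun φ : Modulated m => φ.1 g := by
    intro g
    refine @measurable_of_Ioi _ _ _ _ _ M _ _ _ _ fun t => ?_
    have e₁ : smoothing hmw b ⁻¹' ((fun φ : Modulated m => φ.1 g) ⁻¹' Set.Ioi t) =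
        denseUnion b {k | t < w (g⁻¹ * k)} := by
      ext x
      exact lt_smoothing_iff hmw b x g t
    have e₂ : smoothing hmw b ⁻¹' ((h⁻¹ • ·) ⁻¹' ((fun φ : Modulated m => φ.1 g) ⁻¹' Set.Ioi t)) =
        denseUnion b ((h⁻¹ * ·) ⁻¹' {k | t < w (g⁻¹ * k)}) := by
      ext x
      refine (lt_smoothing_iff hmw b x (h⁻¹⁻¹ * g) t).trans ?_
      simp [mul_assoc]
    have hO : IsOpen {k | t < w (g⁻¹ * k)} :=
      isOpen_lt continuous_const (hw.comp (continuous_const_mul _))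
    refine ⟨e₁ ▸ measurableSet_denseUnion hb _, e₂ ▸ measurableSet_denseUnion hb _, ?_⟩
    refine Eq.trans ?_ ((apply_mk_denseUnion hb hbα h hO).trans ?_)
    · exact congrArg _ (MeasAlg.mk_eq_mk.2 (Filter.EventuallyEq.of_eq e₁))
    · exact MeasAlg.mk_eq_mk.2 (Filter.EventuallyEq.of_eq e₂.symm)
  have hrM : @Measurable _ _ M _
      (fun (φ : Modulated m) (n : ℕ) => φ.1 (denseSeq G n)) :=
    @measurable_pi_lambda _ _ _ M _ _ fun n => heval (denseSeq G n)
  have hCM := hrM hCr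
  rw [Set.preimage_image_eq _ hinj] at hCM
  exact hCM.2.2

end

section

variable {G : Type*} [Group G] [TopologicalSpace G] [IsTopologicalGroup G] [PolishSpace G]
  [MeasurableSpace G] [BorelSpace G] {X : Type*} [MeasurableSpace X] {μ : Measure X}
  [IsProbabilityMeasure μ] {α : BooleanAction G μ}

/-- An action that is not whirly has a nontrivial spatial factor: if `A` is disjoint from all
translates of `B` by elements of a neighbourhood `U`, then the smoothed indicator function of `B`
with a bump function supported in `U` is positive on `B` and zero on `A`. -/
theorem exists_isSpatial_not_isTrivial (hα : ¬ IsWhirly α) :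
    ∃ D : Factor α, D.IsSpatial ∧ ¬ D.IsTrivial := by
  unfold IsWhirly at hα
  push Not at hα
  obtain ⟨A, B, hA, hB, U, hU, hAB⟩ := hα
  obtain ⟨w, hwc, hw1, hwU, hwu⟩ := exists_uniform_bump hU
  obtain ⟨m, hm, hmw⟩ := exists_modulus hwu
  have hrep : ∀ a : MeasAlg μ, ∃ (b : Set X) (hb : MeasurableSet b), MeasAlg.mk μ b hb = a :=
    MeasAlg.ind fun b hb => ⟨b, hb, rfl⟩
  choose b hb hbα using fun n => hrep ((α (TopologicalSpace.denseSeq G n)).1 B)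
  have := Modulated.polishSpace hm
  -- an equivariantly isomorphic copy of `Modulated m` in the lowest universe
  obtain ⟨e, he⟩ := exists_measurableEmbedding_real (Modulated m)
  let Y : Type := Set.range e
  have : StandardBorelSpace Y := he.measurableSet_range.standardBorel
  let E : Modulated m ≃ᵐ Y := he.equivRange
  let : MulAction G Y := E.symm.toEquiv.mulAction G
  have hsmulE : ∀ (g : G) (y : Y), g • y = E (g • E.symm y) := fun _ _ => rfl
  have hsmul : Measurable fun p : G × Y => p.1 • p.2 :=
    E.measurable.comp ((Modulated.continuous_smul hm).measurable.comp
      (measurable_fst.prodMk (E.symm.measurable.comp measurable_snd)))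
  have hπ : Measurable (E ∘ smoothing hmw b) :=
    E.measurable.comp (measurable_smoothing hb hm hmw)
  obtain ⟨D, hD, hmem⟩ := exists_isSpatial_of_map (α := α) hsmul hπ fun g C hC hC' => by
    have hpre : E ⁻¹' ((g⁻¹ • ·) ⁻¹' C) = (g⁻¹ • ·) ⁻¹' (E ⁻¹' C) := by
      ext φ
      simp [hsmulE]
    have := apply_mk_preimage_smoothing hb hm hmw hwc hbα g (E ⁻¹' C) (E.measurable hC)
      (hpre ▸ E.measurable hC')
    refine this.trans (MeasAlg.mk_eq_mk.2 (Filter.EventuallyEq.of_eq ?_))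
    rw [← hpre]
    rfl
  refine ⟨D, hD, fun hD' => ?_⟩
  let O : Set G := {k | 0 < w (1⁻¹ * k)}
  have hO : IsOpen O := isOpen_lt continuous_const (hwc.comp (continuous_const_mul _))
  have hlub := isLUB_denseUnion hb hbα hO
  set S := MeasAlg.mk μ (denseUnion b O) (measurableSet_denseUnion hb O)
  have hSD : S ∈ D.carrier := by
    have hC : IsOpen {φ : Modulated m | 0 < φ.1 1} :=
      isOpen_lt continuous_const ((continuous_apply 1).comp continuous_subtype_val)
    have hpre : denseUnion b O = (E ∘ smoothing hmw b) ⁻¹' (E.symm ⁻¹' {φ | 0 < φ.1 1}) := by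
      ext x
      rw [Set.mem_preimage, Set.mem_preimage, Function.comp, E.symm_apply_apply]
      exact (lt_smoothing_iff hmw b x 1 0).symm
    convert hmem _ (E.symm.measurable hC.measurableSet) using 1
    exact MeasAlg.mk_eq_mk.2 (Filter.EventuallyEq.of_eq hpre)
  rcases hD' S hSD with h0 | h1
  · have hle : (α 1).1 B ≤ S := hlub.1 ⟨1, by simpa [O] using hw1, rfl⟩
    rw [h0, le_bot_iff, map_one] at hle
    exact hB.ne' (MeasAlg.measure_eq_zero_iff.2 hle)
  · have hle : S ≤ Aᶜ := by
      refine hlub.2 ?_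
      rintro _ ⟨g, hg, rfl⟩
      have hgU : g ∈ U := hwU g (by simpa [O] using hg)
      have := MeasAlg.measure_eq_zero_iff.1 (le_antisymm (hAB g hgU) zero_le)
      exact le_compl_iff_disjoint_left.2 (disjoint_iff.2 this)
    rw [h1, top_le_iff, compl_eq_top] at hle
    exact hA.ne' (MeasAlg.measure_eq_zero_iff.2 hle)

end

end Whirly

theorem mainTheorem1 {G : Type*} [Group G] [TopologicalSpace G] [IsTopologicalGroup G]
    [PolishSpace G] [MeasurableSpace G] [BorelSpace G]
    {X : Type*} [MeasurableSpace X] [StandardBorelSpace X]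
    (μ : MeasureTheory.Measure X) [MeasureTheory.IsProbabilityMeasure μ]
    (α : Whirly.BooleanAction G μ) :
    Whirly.IsWhirly α ↔ ∀ D : Whirly.Factor α, D.IsSpatial → D.IsTrivial := by
  refine ⟨fun hα D hD => hα.isTrivial_of_isSpatial hD, fun h => ?_⟩
  by_contra hα
  obtain ⟨D, hD, hD'⟩ := Whirly.exists_isSpatial_not_isTrivial hα
  exact hD' (h D hD)
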